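/- Let $V$ be a countable set, $\Sigma=\{+1,-1\}^V$ with the coordinatewise order, and for $\sigma\in\Sigma$, $v\in V$ let $\sigma^v$ be $\sigma$ with the spin at $v$ reversed. Let $c_t(v,\sigma)\ge 0$ ($t\ge 0$, $v\in V$, $\sigma\in\Sigma$) be flip rates, measurable in $t$, such that - (Glauber) $c_t(v,\sigma)=1-c_t(v,\sigma^v)$ for all $t,v,\sigma$; - (bounded range) there are sets $A_v\subset V$ with $\sup_{v}|A_v|<\infty$ such that $c_t(v,\sigma)$ depends on $\sigma$ only through $(\sigma(u))_{u\in A_v}$; - (attractive) $c_t(v,\sigma)$ is increasing in $\sigma$ on $\{\sigma(v)=-1\}$ and decreasing in $\sigma$ on $\{\sigma(v)=+1\}$. Let $p\in(0,1]$ and let $(\sigma_t)_{t\ge 0}$ be a right-continuous spin system with flip rates $c_t$ whose initial configuration $\sigma_0$ has the Bernoulli product law with density $p$ of spins $+1$; that is, $(\sigma_t)_{t\ge0}$ has the law of the process given by the Harris graphical construction: $\sigma_0$, independent rate-$1$ Poisson processes with arrival times $\tau_{v,1}<\tau_{v,2}<\cdots$ ($v\in V$) and i.i.d. uniform variables $U_{v,n}$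 on $[0,1]$ are all independent; the spin at $v$ can change only at the times $\tau_{v,n}$, and at time $\tau_{v,n}$ it is reversed if and only if $U_{v,n}<c_{\tau_{v,n}}(v,\sigma_{\tau_{v,n}^-})$. A vertex fixates at the value $+1$ if its spin flips only finitely many times and is eventually equal to $+1$; it fixates at the value $+1$ from time zero if its spin never flips and equals $+1$ at all times $t\ge 0$. If a vertex $w\in V$ fixates at the value $+1$ with positive probability, then $w$ fixates at the value $+1$ from time zero with positive probability. -/

import Mathlib

open MeasureTheory ProbabilityTheory Set Filter
open scoped NNReal Topology

noncomputable section

/-- Configurations `Σ = {+1, -1}^V`, with the coordinatewise order, the product topology (each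
factor is discrete) and the product σ-algebra. -/
abbrev SpinConfig (V : Type*) := V → ℤˣ

open Classical in
/-- The configuration `η^v`, which is `η` with the spin at `v` reversed. -/
def SpinConfig.flip {V : Type*} (η : SpinConfig V) (v : V) : SpinConfig V :=
  Function.update η v (-η v)

/-- Flip rates `c t v η` of a Glauber dynamics: non-negative, measurable in time and such that
`c t v η = 1 - c t v (η^v)`. In particular they take values in `[0, 1]`. -/
structure IsGlauberRate {V : Type*} (c : ℝ≥0 → V → SpinConfig V → ℝ) : Prop where
  nonneg : ∀ t v η, 0 ≤ c t v η
  measurable_time : ∀ v η, Measurable fun t => c t v η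
  glauber : ∀ t v η, c t v η = 1 - c t v (η.flip v)

/-- `c t v η` depends on `η` only through its restriction to a finite set `A v`, where the
cardinalities of the sets `A v` are bounded. -/
def HasBoundedRange {V : Type*} (c : ℝ≥0 → V → SpinConfig V → ℝ) : Prop :=
  ∃ A : V → Finset V, (∃ K : ℕ, ∀ v, (A v).card ≤ K) ∧
    ∀ t v η ξ, (∀ u ∈ A v, η u = ξ u) → c t v η = c t v ξ

/-- `c t v η` is increasing in `η` when `η v = -1` and decreasing in `η` when `η v = +1`. -/
structure IsAttractive {V : Type*} (c : ℝ≥0 → V → SpinConfig V → ℝ) : Prop where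
  mono : ∀ t v η ξ, η ≤ ξ → η v = -1 → ξ v = -1 → c t v η ≤ c t v ξ
  anti : ∀ t v η ξ, η ≤ ξ → η v = 1 → ξ v = 1 → c t v ξ ≤ c t v η

/-- The randomness of the Harris graphical representation: an initial configuration, the
interarrival times of the clock of each vertex, and the variables `U (v, n)`. -/
abbrev HarrisData (V : Type*) := SpinConfig V × (V × ℕ → ℝ) × (V × ℕ → unitInterval)

/-- The law of the driving randomness. All coordinates are independent; initial spins are `+1` with
probability `p` and `-1` with probability `1 - p`, interarrival times are exponential of rate `1`
(so that the clocks are independent Poisson processes of rate `1`), and the `U (v, n)` are uniform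
on `[0, 1]`. -/
def harrisMeasure (V : Type*) (p : unitInterval) : Measure (HarrisData V) :=
  (Measure.infinitePi fun _ : V => bernoulliMeasure (1 : ℤˣ) (-1) p).prod
    ((Measure.infinitePi fun _ : V × ℕ => expMeasure 1).prod
      (Measure.infinitePi fun _ : V × ℕ => (volume : Measure unitInterval)))

namespace HarrisData

variable {V : Type*}

/-- The initial configuration. -/
def init (d : HarrisData V) : SpinConfig V := d.1

/-- The arrival time `τ_{v,n}` (`n = 0` is the first arrival) of the clock of `v`. -/
def arrival (d : HarrisData V) (v : V) (n : ℕ) : ℝ≥0 :=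
  ∑ k ∈ Finset.range (n + 1), (d.2.1 (v, k)).toNNReal

/-- The variable `U_{v,n}` in `[0, 1]`. -/
def unif (d : HarrisData V) (v : V) (n : ℕ) : ℝ := d.2.2 (v, n)

end HarrisData

/-- `x` is a trajectory of the graphical construction with rates `c` and driving data `d`: it starts
from the initial configuration, the spin at `v` can change only at the arrivals of the clock of
`v`, and at the arrival time `τ = τ_{v,n}` it is reversed if and only if `U_{v,n} < c τ v (x (τ-))`,
where `x (τ-)` is the left limit. -/
structure IsHarrisPath {V : Type*} (c : ℝ≥0 → V → SpinConfig V → ℝ) (d : HarrisData V)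
    (x : ℝ≥0 → SpinConfig V) : Prop where
  init : x 0 = d.init
  rightCts : ∀ t, ContinuousWithinAt x (Ici t) t
  const : ∀ v s t, s ≤ t → (∀ n, d.arrival v n ∉ Ioc s t) → x t v = x s v
  jump : ∀ v n, ∃ η : SpinConfig V, Tendsto x (𝓝[<] (d.arrival v n)) (𝓝 η) ∧
    x (d.arrival v n) v = if d.unif v n < c (d.arrival v n) v η then -η v else η v

/-- `σ` is a spin system with flip rates `c` whose initial configuration is Bernoulli with density
`p`: it has right-continuous paths, and it has the law (on path space, with the product σ-algebra)
of the process given by the Harris graphical construction. -/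
structure IsSpinSystem {V : Type*} (c : ℝ≥0 → V → SpinConfig V → ℝ) (p : unitInterval)
    {Ω : Type*} [MeasurableSpace Ω] (P : Measure Ω) (σ : ℝ≥0 → Ω → SpinConfig V) : Prop where
  rightCts : ∀ᵐ ω ∂P, ∀ t, ContinuousWithinAt (fun s => σ s ω) (Ici t) t
  law : ∃ X : ℝ≥0 → HarrisData V → SpinConfig V,
    (∀ᵐ d ∂(harrisMeasure V p), IsHarrisPath c d fun t => X t d) ∧
    IdentDistrib (fun ω t => σ t ω) (fun d t => X t d) P (harrisMeasure V p)

/-- The times at which the spin at `v` flips along the trajectory `x`. -/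
def flipTimes {V : Type*} (x : ℝ≥0 → SpinConfig V) (v : V) : Set ℝ≥0 :=
  {t | 0 < t ∧ ∀ᶠ s in 𝓝[<] t, x s v = -x t v}

/-- The vertex `v` fixates at the value `a`: its spin flips only finitely many times and is
eventually equal to `a`. -/
def FixatesAt {V : Type*} (x : ℝ≥0 → SpinConfig V) (v : V) (a : ℤˣ) : Prop :=
  (flipTimes x v).Finite ∧ ∀ᶠ t in atTop, x t v = a

/-- The vertex `v` fixates at the value `a` from time zero: its spin never flips and equals `a` at
all times. -/
def FixatesFromTimeZeroAt {V : Type*} (x : ℝ≥0 → SpinConfig V) (v : V) (a : ℤˣ) : Prop :=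
  flipTimes x v = ∅ ∧ ∀ t, x t v = a

end

/-! Replacing `U` by `1 - U` whenever the spin to be updated is `+1` does not change the law of the
process (`measurePreserving_reflectedUniforms`). By the Glauber identity the updated spin is then
`+1` iff, up to ties, `U` lies below the rate at `v` of the configuration with its spin at `v` set
to `-1`. Attractiveness makes this increasing in the configuration (`spinUpdate_reflect_mono`), so
the reflected evolution is monotone path by path.

Suppose that with positive probability `w` is `+1` after each arrival from the `(m+1)`-st on. Delete
the first arrival at `w` and set its initial spin to `+1`. Spins only increase
(`spinState_le_spinState_skip`), so `w` is now `+1` from its `m`-th arrival on. The modified data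
have a law absolutely continuous with respect to the original one: two interarrival times merge into
one, and `+1` has initial mass `p > 0`. Hence positive probability descends from `m + 1` to `m`, and
finally to `0`, which is fixation from time zero. The proof runs the contrapositive, with null
events (`ae_not_staysOne_succ`).

Pathwise comparison requires the construction to be a well-founded recursion over arrivals. An
infinite backward chain of influences would produce, in an arbitrarily short time window, an
infinite self-avoiding path of ringing vertices; a first-moment bound excludes this
(`ae_no_infinite_open_path`, `wellFounded_influences`). Every Harris path then equals the recursive
solution (`IsHarrisPath.eq_spinState`). -/

/-! ### Relabelling and resampling i.i.d. families -/

section ProductMeasure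

variable {α β X : Type*} [MeasurableSpace X] (μ : Measure X) [IsProbabilityMeasure μ]

/-- Relabelling i.i.d. variables along an injective map gives i.i.d. variables. -/
theorem measurePreserving_infinitePi_comp {g : α → β} (hg : Function.Injective g) :
    MeasurePreserving (fun (ζ : β → X) a => ζ (g a))
      (Measure.infinitePi fun _ : β => μ) (Measure.infinitePi fun _ : α => μ) where
  measurable := by fun_prop
  map_eq := by
    classical
    refine Measure.eq_infinitePi _ fun s t ht => ?_
    rw [Measure.map_apply (by fun_prop) (.pi s.countable_toSet fun _ _ => ht _)]
    have : (fun (ζ : β → X) a => ζ (g a)) ⁻¹' (s : Set α).pi t =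
        ((s.image g : Finset β) : Set β).pi
          (fun b => ⋂ a ∈ s.filter (fun a => g a = b), t a) := by
      ext ζ
      simp only [mem_preimage, Set.mem_pi, Finset.mem_coe, Finset.mem_image, mem_iInter,
        Finset.mem_filter]
      constructor
      · rintro h _ _ a ⟨ha, rfl⟩
        exact h a ha
      · intro h a ha
        exact h (g a) ⟨a, ha, rfl⟩ a ⟨ha, rfl⟩
    rw [this, Measure.infinitePi_pi _ (fun b _ => Finset.measurableSet_biInter _ fun a _ => ht a),
      Finset.prod_image (fun a _ b _ h => hg h)]
    refine Finset.prod_congr rfl fun a ha => ?_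
    congr 1
    ext x
    simp only [mem_iInter, Finset.mem_filter]
    constructor
    · exact fun h => h a ⟨ha, rfl⟩
    · rintro h b ⟨_, hb⟩
      rwa [hg hb]

/-- An i.i.d. family together with one more independent variable is an i.i.d. family indexed
by `Option β`. -/
theorem measurePreserving_prod_infinitePi_option :
    MeasurePreserving (fun (z : X × (β → X)) (o : Option β) => o.elim z.1 z.2)
      (μ.prod (Measure.infinitePi fun _ : β => μ)) (Measure.infinitePi fun _ : Option β => μ) where
  measurable := by
    refine measurable_pi_lambda _ fun o => ?_
    cases o <;> simp only [Option.elim] <;> fun_prop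
  map_eq := by
    classical
    refine Measure.eq_infinitePi _ fun s t ht => ?_
    have hm : Measurable (fun (z : X × (β → X)) (o : Option β) => o.elim z.1 z.2) := by
      refine measurable_pi_lambda _ fun o => ?_
      cases o <;> simp only [Option.elim] <;> fun_prop
    rw [Measure.map_apply hm (.pi s.countable_toSet fun _ _ => ht _)]
    have : (fun (z : X × (β → X)) (o : Option β) => o.elim z.1 z.2) ⁻¹' (s : Set (Option β)).pi t =
        (if none ∈ s then t none else univ) ×ˢ
          (s.eraseNone : Set β).pi (fun b => t (some b)) := by
      ext ⟨x, ζ⟩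
      simp only [mem_preimage, Set.mem_pi, Finset.mem_coe, mem_prod, Finset.mem_eraseNone]
      constructor
      · intro h
        refine ⟨?_, fun b hb => h (some b) hb⟩
        split_ifs with hn
        · exact h none hn
        · trivial
      · rintro ⟨h1, h2⟩ (_ | b) hb
        · exact (if_pos (Finset.mem_coe.1 hb) ▸ h1 :)
        · exact h2 b hb
    rw [this, Measure.prod_prod, Measure.infinitePi_pi _ (fun b _ => ht _)]
    by_cases hn : none ∈ s
    · rw [if_pos hn]
      have h2 : s = insert none (s.eraseNone.map Function.Embedding.some) := by
        simp [Finset.map_some_eraseNone, Finset.insert_erase hn]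
      conv_rhs => rw [h2]
      rw [Finset.prod_insert (by simp), Finset.prod_map]
      rfl
    · have h2 : s = s.eraseNone.map Function.Embedding.some := by
        simp [Finset.map_some_eraseNone, Finset.erase_eq_of_notMem hn]
      conv_rhs => rw [h2]
      rw [if_neg hn, Finset.prod_map, measure_univ, one_mul]
      rfl

/-- A family obtained by an injective relabelling from an i.i.d. family and one more independent
variable is i.i.d. -/
theorem measurePreserving_prod_infinitePi {j : α → Option β} (hj : Function.Injective j) :
    MeasurePreserving (fun (z : X × (β → X)) a => (j a).elim z.1 z.2)
      (μ.prod (Measure.infinitePi fun _ : β => μ)) (Measure.infinitePi fun _ : α => μ) :=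
  (measurePreserving_infinitePi_comp μ hj).comp (measurePreserving_prod_infinitePi_option μ)

/-- Resampling one coordinate preserves an i.i.d. family. -/
theorem measurePreserving_update_infinitePi [DecidableEq α] (i : α) :
    MeasurePreserving (fun z : X × (α → X) => Function.update z.2 i z.1)
      (μ.prod (Measure.infinitePi fun _ : α => μ)) (Measure.infinitePi fun _ : α => μ) := by
  have hj : Function.Injective (fun a : α => if a = i then none else some a) := by
    intro a b h
    by_cases ha : a = i <;> by_cases hb : b = i <;> simp_all
  convert measurePreserving_prod_infinitePi μ hj using 3 with z a
  by_cases ha : a = i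
  · subst ha; simp
  · simp [ha]

/-- The probability of an event is computed by first resampling one coordinate. -/
theorem infinitePi_eq_lintegral_update [DecidableEq α] (i : α) {s : Set (α → X)}
    (hs : MeasurableSet s) :
    Measure.infinitePi (fun _ : α => μ) s =
      ∫⁻ ζ, μ {b | Function.update ζ i b ∈ s} ∂Measure.infinitePi fun _ : α => μ := by
  have h := measurePreserving_update_infinitePi μ i
  rw [← h.measure_preimage hs.nullMeasurableSet,
    Measure.prod_apply_symm (h.measurable hs)]
  rfl

theorem ae_ae_update_infinitePi [DecidableEq α] (i : α) {p : (α → X) → Prop}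
    (hp : ∀ᵐ ζ ∂Measure.infinitePi fun _ : α => μ, p ζ) :
    ∀ᵐ b ∂μ, ∀ᵐ ζ ∂Measure.infinitePi fun _ : α => μ, p (Function.update ζ i b) :=
  Measure.ae_ae_of_ae_prod ((measurePreserving_update_infinitePi μ i).quasiMeasurePreserving.ae hp)

end ProductMeasure

instance instIsProbabilityMeasureExpMeasureOne : IsProbabilityMeasure (expMeasure 1) :=
  isProbabilityMeasure_expMeasure one_pos

/-! ### The exponential law -/

section Exponential

theorem ae_expMeasure_iff {p : ℝ → Prop} :
    (∀ᵐ x ∂expMeasure 1, p x) ↔ ∀ᵐ x : ℝ, 0 ≤ x → p x := by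
  have hm : Measurable (exponentialPDF 1) := (measurable_exponentialPDFReal 1).ennreal_ofReal
  have : expMeasure 1 = volume.withDensity (exponentialPDF 1) := rfl
  rw [this, ae_withDensity_iff hm]
  refine eventually_congr (Eventually.of_forall fun x => ?_)
  rcases le_or_gt 0 x with hx | hx
  · simp [exponentialPDF_of_nonneg hx, hx, Real.exp_pos]
  · simp [exponentialPDF_of_neg hx, hx]

theorem ae_expMeasure_pos : ∀ᵐ x ∂expMeasure 1, 0 < x := by
  rw [ae_expMeasure_iff]
  filter_upwards [Measure.ae_ne volume (0 : ℝ)] with x hx h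
  exact lt_of_le_of_ne h hx.symm

theorem ae_expMeasure_ne (a : ℝ) : ∀ᵐ x ∂expMeasure 1, x ≠ a := by
  rw [ae_expMeasure_iff]
  filter_upwards [Measure.ae_ne volume a] with x hx _ using hx

theorem ae_expMeasure_add {a : ℝ} (ha : 0 ≤ a) {p : ℝ → Prop} (hp : ∀ᵐ x ∂expMeasure 1, p x) :
    ∀ᵐ x ∂expMeasure 1, p (x + a) := by
  rw [ae_expMeasure_iff] at hp ⊢
  filter_upwards [(measurePreserving_add_right volume a).quasiMeasurePreserving.ae hp] with x hx h
  exact hx (add_nonneg h ha)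

theorem expMeasure_Iic_lt_one (a : ℝ) : expMeasure 1 (Iic a) < 1 := by
  have h := cdf_expMeasure_eq one_pos a
  rw [cdf_eq_real] at h
  have h1 : (expMeasure 1).real (Iic a) < 1 := by
    rw [h]
    split_ifs
    · linarith [Real.exp_pos (-(1 * a))]
    · exact one_pos
  rw [Measure.real] at h1
  exact (ENNReal.toReal_lt_toReal (measure_ne_top _ _) ENNReal.one_ne_top).1 (by simpa using h1)

end Exponential

/-! ### Arrival times of a single clock -/

section Renewal

/-- The time of the `n`-th arrival of the clock with interarrival times `ζ`. -/
noncomputable def renewalTime (ζ : ℕ → ℝ) (n : ℕ) : ℝ≥0 :=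
  ∑ k ∈ Finset.range (n + 1), (ζ k).toNNReal

/-- The law of the interarrival times of one clock. -/
noncomputable abbrev clockMeasure : Measure (ℕ → ℝ) := Measure.infinitePi fun _ : ℕ => expMeasure 1

@[fun_prop]
theorem measurable_renewalTime (n : ℕ) : Measurable fun ζ => renewalTime ζ n := by
  unfold renewalTime
  fun_prop

theorem ae_clockMeasure_pos : ∀ᵐ ζ ∂clockMeasure, ∀ k, 0 < ζ k :=
  ae_all_iff.2 fun k =>
    (measurePreserving_eval_infinitePi (fun _ : ℕ => expMeasure 1) k).quasiMeasurePreserving.ae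
      ae_expMeasure_pos

theorem strictMono_renewalTime {ζ : ℕ → ℝ} (h : ∀ k, 0 < ζ k) : StrictMono (renewalTime ζ) := by
  refine strictMono_nat_of_lt_succ fun n => ?_
  rw [renewalTime, renewalTime, Finset.sum_range_succ _ (n + 1)]
  exact lt_add_of_pos_right _ (Real.toNNReal_pos.2 (h _))

/-- Independence bounds the probability by `q ^ n` for every `n`, with `q < 1`. Arbitrarily large
single interarrival times already force the arrivals to diverge. -/
theorem ae_clockMeasure_exists_gt (M : ℝ) : ∀ᵐ ζ ∂clockMeasure, ∃ k, M < ζ k := by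
  rw [ae_iff]
  refine le_antisymm (ge_of_tendsto' (ENNReal.tendsto_pow_atTop_nhds_zero_of_lt_one
    (expMeasure_Iic_lt_one M)) fun n => ?_) zero_le
  calc clockMeasure {ζ | ¬ ∃ k, M < ζ k}
      ≤ clockMeasure ((Finset.range n : Set ℕ).pi fun _ => Iic M) :=
        measure_mono fun ζ h k _ => by
          simp only [mem_ofPred_eq, not_exists, not_lt] at h
          exact h k
    _ = expMeasure 1 (Iic M) ^ n := by
        rw [Measure.infinitePi_pi _ (fun _ _ => measurableSet_Iic)]
        simp

theorem ae_tendsto_renewalTime :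
    ∀ᵐ ζ ∂clockMeasure, Tendsto (renewalTime ζ) atTop atTop := by
  have h : ∀ᵐ ζ ∂clockMeasure, ∀ M : ℕ, ∃ k, (M : ℝ) < ζ k :=
    ae_all_iff.2 fun M => ae_clockMeasure_exists_gt M
  filter_upwards [h] with ζ h
  refine tendsto_atTop_atTop_of_monotone (monotone_nat_of_le_succ fun n => ?_) fun b => ?_
  · rw [renewalTime, renewalTime, Finset.sum_range_succ _ (n + 1)]
    exact le_self_add
  · obtain ⟨M, hM⟩ := exists_nat_ge b
    obtain ⟨k, hk⟩ := h M
    refine ⟨k, hM.trans ?_⟩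
    calc (M : ℝ≥0) ≤ (ζ k).toNNReal := by
          rw [← Real.toNNReal_natCast]; exact Real.toNNReal_le_toNNReal hk.le
      _ ≤ renewalTime ζ k :=
          Finset.single_le_sum (f := fun k => (ζ k).toNNReal) (fun _ _ => zero_le)
            (Finset.mem_range.2 (Nat.lt_succ_self k))

/-- Given the other interarrival times, the arrival is a constant plus an exponential variable,
which has no atoms. -/
theorem ae_renewalTime_ne (n : ℕ) (s : ℝ≥0) : ∀ᵐ ζ ∂clockMeasure, renewalTime ζ n ≠ s := by
  have hs : MeasurableSet {ζ | ¬ renewalTime ζ n ≠ s} := by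
    simp only [ne_eq, not_not]
    exact measurable_renewalTime n (measurableSet_singleton s)
  rw [ae_iff, infinitePi_eq_lintegral_update _ n hs]
  refine (lintegral_congr fun ζ => ?_).trans lintegral_zero
  change expMeasure 1 {b | ¬ renewalTime (Function.update ζ n b) n ≠ s} = 0
  rw [← ae_iff]
  set r := ∑ k ∈ Finset.range n, (ζ k).toNNReal
  filter_upwards [ae_expMeasure_pos, ae_expMeasure_ne ((s : ℝ) - r)] with b hb hne h
  apply hne
  have h2 : renewalTime (Function.update ζ n b) n = r + b.toNNReal := by
    rw [renewalTime, Finset.sum_range_succ, Function.update_self]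
    congr 1
    refine Finset.sum_congr rfl fun k hk => ?_
    rw [Function.update_of_ne (Finset.mem_range.1 hk).ne]
  rw [← h, h2]
  simp [hb.le]

/-- Around every time there is a neighbourhood in which the clock rings with small probability. -/
theorem exists_nhds_clockMeasure_le (s : ℝ≥0) {ε : ENNReal} (hε : 0 < ε) :
    ∃ I : Set ℝ≥0, I ∈ 𝓝 s ∧ MeasurableSet I ∧
      clockMeasure {ζ | ∃ n, renewalTime ζ n ∈ I} ≤ ε := by
  -- The ringing events for shrinking balls decrease to a null event: arrivals tend to infinity and
  -- almost surely avoid `s`, so they keep a positive distance from `s`.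
  let I : ℕ → Set ℝ≥0 := fun k => Metric.closedBall s (1 / (k + 1))
  let B : ℕ → Set (ℕ → ℝ) := fun k => {ζ | ∃ n, renewalTime ζ n ∈ I k}
  have hI : ∀ k, MeasurableSet (I k) := fun k => Metric.isClosed_closedBall.measurableSet
  have hB : ∀ k, MeasurableSet (B k) := fun k => by
    have : B k = ⋃ n, (fun ζ => renewalTime ζ n) ⁻¹' I k := by ext; simp [B]
    rw [this]
    exact MeasurableSet.iUnion fun n => measurable_renewalTime n (hI k)
  have hanti : Antitone B := by
    rintro k l hkl ζ ⟨n, hn⟩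
    exact ⟨n, Metric.closedBall_subset_closedBall
      (one_div_le_one_div_of_le (by positivity) (by gcongr)) hn⟩
  have h0 : clockMeasure (⋂ k, B k) = 0 := by
    have h : ∀ᵐ ζ ∂clockMeasure, ∀ n, renewalTime ζ n ≠ s :=
      ae_all_iff.2 fun n => ae_renewalTime_ne n s
    refine measure_mono_null (fun ζ hζ => ?_) (ae_iff.1 (h.and ae_tendsto_renewalTime))
    rintro ⟨hne, htop⟩
    obtain ⟨N, hN⟩ := eventually_atTop.1 (htop.eventually_gt_atTop (s + 1))
    have hev : ∀ᶠ k : ℕ in atTop, ∀ n ∈ Finset.range N, 1 / ((k : ℝ) + 1) < dist (renewalTime ζ n) s :=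
      (Finset.eventually_all _).2 fun n _ =>
        tendsto_one_div_add_atTop_nhds_zero_nat.eventually_lt_const (dist_pos.2 (hne n))
    obtain ⟨k, hk⟩ := hev.exists
    obtain ⟨n, hn⟩ := mem_iInter.1 hζ k
    rw [Metric.mem_closedBall] at hn
    rcases lt_or_ge n N with hnN | hnN
    · exact (hk n (Finset.mem_range.2 hnN)).not_ge hn
    · have h1 : ((s + 1 : ℝ≥0) : ℝ) < renewalTime ζ n := by exact_mod_cast hN n hnN
      have h2 : (1 : ℝ) / (k + 1) ≤ 1 := by
        rw [div_le_one (by positivity)]; linarith [(Nat.cast_nonneg k : (0 : ℝ) ≤ k)]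
      rw [NNReal.dist_eq] at hn
      push_cast at h1
      linarith [le_abs_self ((renewalTime ζ n : ℝ) - s)]
  have ht := tendsto_measure_iInter_atTop (μ := clockMeasure)
    (fun k => (hB k).nullMeasurableSet) hanti ⟨0, measure_ne_top _ _⟩
  rw [h0] at ht
  obtain ⟨k, hk⟩ := (ht.eventually_le_const hε).exists
  exact ⟨I k, Metric.closedBall_mem_nhds _ (by positivity), hI k, hk⟩

end Renewal

/-! ### Self-avoiding walks -/

section SelfAvoiding

variable {V : Type*}

/-- A walk which visits each vertex finitely often contains an infinite self-avoiding walk. -/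
theorem exists_injective_subwalk {r : V → V → Prop} (v : ℕ → V)
    (hfin : ∀ u, {i | v i = u}.Finite) (h : ∀ i, r (v i) (v (i + 1))) :
    ∃ φ : ℕ → ℕ, Function.Injective (v ∘ φ) ∧ ∀ i, r (v (φ i)) (v (φ (i + 1))) := by
  have hlast : ∀ i, ∃ l, i ≤ l ∧ v l = v i ∧ ∀ j, v j = v i → j ≤ l := fun i => by
    obtain ⟨l, hl, hmax⟩ := Set.exists_max_image _ id (hfin (v i)) ⟨i, rfl⟩
    exact ⟨l, hmax i rfl, hl, fun j hj => hmax j hj⟩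
  choose last h1 h2 h3 using hlast
  -- Loop erasure: move to the last visit of the current vertex and then take one step, so that the
  -- vertex is never seen again.
  let φ : ℕ → ℕ := fun k => (fun i => last i + 1)^[k] 0
  have hφ : ∀ k, φ (k + 1) = last (φ k) + 1 := fun k => Function.iterate_succ_apply' _ _ _
  have hmono : StrictMono φ := strictMono_nat_of_lt_succ fun k => by
    rw [hφ]; exact Nat.lt_succ_of_le (h1 _)
  refine ⟨φ, ?_, fun i => ?_⟩
  · have key : ∀ k l, k < l → v (φ l) ≠ v (φ k) := fun k l hkl he => by
      have := h3 _ _ he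
      have h4 := hmono.monotone (Nat.succ_le_of_lt hkl)
      rw [Nat.succ_eq_add_one, hφ] at h4
      omega
    intro k l hkl
    rcases lt_trichotomy k l with hlt | heq | hlt
    · exact absurd hkl.symm (key _ _ hlt)
    · exact heq
    · exact absurd hkl (key _ _ hlt)
  · rw [hφ, ← h2]
    exact h _

open Classical in
/-- The walks with `L` steps from `v`, where the steps from `u` lead to the elements of `N u`. -/
noncomputable def walks (N : V → Finset V) : ℕ → V → Finset (List V)
  | 0, v => {[v]}
  | L + 1, v => (N v).biUnion fun u => (walks N L u).image (List.cons v)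

theorem card_walks_le {N : V → Finset V} {K : ℕ} (hN : ∀ v, (N v).card ≤ K) (L : ℕ) (v : V) :
    (walks N L v).card ≤ K ^ L := by
  classical
  induction L generalizing v with
  | zero => simp [walks]
  | succ L ih =>
    rw [walks, pow_succ']
    refine (Finset.card_biUnion_le_card_mul (N v) _ (K ^ L) fun u _ => ?_).trans
      (Nat.mul_le_mul_right _ (hN v))
    exact Finset.card_image_le.trans (ih u)

theorem ofFn_mem_walks {N : V → Finset V} {g : ℕ → V} (hg : ∀ i, g (i + 1) ∈ N (g i)) (L : ℕ) :
    List.ofFn (fun i : Fin (L + 1) => g i) ∈ walks N L (g 0) := by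
  classical
  induction L generalizing g with
  | zero => simp [walks]
  | succ L ih =>
    rw [walks, Finset.mem_biUnion]
    refine ⟨g 1, hg 0, Finset.mem_image.2 ⟨_, ih (g := fun i => g (i + 1)) fun i => hg _, ?_⟩⟩
    rw [List.ofFn_succ (n := L + 1)]
    simp

end SelfAvoiding

/-! ### First-moment bound for open paths -/

section Percolation

variable {V : Type*}

/-- The law of the interarrival times of all clocks. -/
noncomputable abbrev clocksMeasure (V : Type*) : Measure (V × ℕ → ℝ) :=
  Measure.infinitePi fun _ : V × ℕ => expMeasure 1

theorem clocksMeasure_forall_mem {R : Set (ℕ → ℝ)} (hR : MeasurableSet R) (s : Finset V) :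
    clocksMeasure V {ξ | ∀ v ∈ s, (fun k => ξ (v, k)) ∈ R} = clockMeasure R ^ s.card := by
  have h := Measure.infinitePi_map_curry (fun (_ : V) (_ : ℕ) => expMeasure 1)
  have hs : MeasurableSet ((s : Set V).pi fun _ => R) := .pi s.countable_toSet fun _ _ => hR
  have h2 := congrArg (fun m => m ((s : Set V).pi fun _ => R)) h
  rw [Measure.map_apply (by fun_prop) hs, Measure.infinitePi_pi _ (fun _ _ => hR)] at h2
  rw [Finset.prod_const] at h2
  exact h2

/-- If every vertex has at most `K` successors and is open with probability less than `1 / K`, then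
there is no infinite open self-avoiding path. -/
theorem ae_no_infinite_open_path [Countable V] {N : V → Finset V} {K : ℕ}
    (hN : ∀ v, (N v).card ≤ K) {R : Set (ℕ → ℝ)} (hR : MeasurableSet R)
    (hK : K * clockMeasure R < 1) :
    ∀ᵐ ξ ∂clocksMeasure V, ∀ g : ℕ → V, Function.Injective g → (∀ i, g (i + 1) ∈ N (g i)) →
      ∃ i, (fun k => ξ (g i, k)) ∉ R := by
  classical
  have key : ∀ v, ∀ᵐ ξ ∂clocksMeasure V, ∀ g : ℕ → V, g 0 = v → Function.Injective g →
      (∀ i, g (i + 1) ∈ N (g i)) → ∃ i, (fun k => ξ (g i, k)) ∉ R := by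
    intro v
    rw [ae_iff]
    -- There are at most `K ^ L` walks of `L` steps. A self-avoiding one uses `L + 1` distinct,
    -- hence independent, clocks, so it is open with probability at most `clockMeasure R ^ L`.
    refine le_antisymm (ge_of_tendsto' (ENNReal.tendsto_pow_atTop_nhds_zero_of_lt_one hK)
      fun L => ?_) zero_le
    calc _ ≤ clocksMeasure V (⋃ l ∈ (walks N L v).filter (fun l => l.Nodup ∧ l.length = L + 1),
          {ξ | ∀ u ∈ l.toFinset, (fun k => ξ (u, k)) ∈ R}) := by
          refine measure_mono fun ξ hξ => ?_
          simp only [mem_ofPred_eq, not_forall, not_exists, not_not] at hξ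
          obtain ⟨g, h0, hinj, hstep, hopen⟩ := hξ
          simp only [mem_iUnion, Finset.mem_filter]
          refine ⟨List.ofFn (fun i : Fin (L + 1) => g i), ⟨h0 ▸ ofFn_mem_walks hstep L, ?_, ?_⟩, ?_⟩
          · exact List.nodup_ofFn.2 fun i j hij => Fin.ext (hinj hij)
          · simp
          · intro u hu
            rw [List.mem_toFinset, List.mem_ofFn] at hu
            obtain ⟨i, rfl⟩ := hu
            exact hopen i
      _ ≤ ∑ l ∈ (walks N L v).filter (fun l => l.Nodup ∧ l.length = L + 1),
          clocksMeasure V {ξ | ∀ u ∈ l.toFinset, (fun k => ξ (u, k)) ∈ R} :=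
        measure_biUnion_finset_le _ _
      _ ≤ ∑ l ∈ (walks N L v).filter (fun l => l.Nodup ∧ l.length = L + 1), clockMeasure R ^ L := by
        refine Finset.sum_le_sum fun l hl => ?_
        obtain ⟨-, hnd, hlen⟩ := Finset.mem_filter.1 hl
        rw [clocksMeasure_forall_mem hR, List.toFinset_card_of_nodup hnd, hlen, pow_succ]
        exact mul_le_of_le_one_right' prob_le_one
      _ ≤ (K * clockMeasure R) ^ L := by
        rw [Finset.sum_const, nsmul_eq_mul, mul_pow]
        gcongr
        exact_mod_cast (Finset.card_filter_le _ _).trans (card_walks_le hN L v)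
  filter_upwards [ae_all_iff.2 key] with ξ hξ g using hξ (g 0) g rfl

end Percolation

/-! ### Well-foundedness of the backward influences -/

section Dependency

variable {V : Type*}

/-- The number of arrivals before time `t`. -/
noncomputable def ringsBefore (T : ℕ → ℝ≥0) (t : ℝ≥0) : ℕ := sInf {n | t ≤ T n}

/-- The number of arrivals up to time `t`. -/
noncomputable def ringsUpTo (T : ℕ → ℝ≥0) (t : ℝ≥0) : ℕ := sInf {n | t < T n}

theorem lt_of_lt_ringsBefore {T : ℕ → ℝ≥0} {t : ℝ≥0} {k : ℕ} (h : k < ringsBefore T t) :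
    T k < t :=
  not_le.1 fun h' => (Nat.sInf_le (s := {n | t ≤ T n}) h').not_gt h

theorem le_of_lt_ringsUpTo {T : ℕ → ℝ≥0} {t : ℝ≥0} {k : ℕ} (h : k < ringsUpTo T t) :
    T k ≤ t :=
  not_lt.1 fun h' => (Nat.sInf_le (s := {n | t < T n}) h').not_gt h

theorem le_ringsBefore {T : ℕ → ℝ≥0} (hT : Tendsto T atTop atTop) (t : ℝ≥0) :
    t ≤ T (ringsBefore T t) :=
  Nat.sInf_mem (s := {n | t ≤ T n}) (hT.eventually_ge_atTop t).exists

theorem lt_ringsUpTo {T : ℕ → ℝ≥0} (hT : Tendsto T atTop atTop) (t : ℝ≥0) :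
    t < T (ringsUpTo T t) :=
  Nat.sInf_mem (s := {n | t < T n}) (hT.eventually_gt_atTop t).exists

theorem ringsBefore_eq {T : ℕ → ℝ≥0} {t : ℝ≥0} {n : ℕ}
    (h1 : ∀ k < n, T k < t) (h2 : t ≤ T n) : ringsBefore T t = n := by
  refine le_antisymm (Nat.sInf_le h2) (not_lt.1 fun h => ?_)
  have := Nat.sInf_mem (s := {n | t ≤ T n}) ⟨n, h2⟩
  exact (h1 _ h).not_ge this

theorem ringsUpTo_eq {T : ℕ → ℝ≥0} {t : ℝ≥0} {n : ℕ}
    (h1 : ∀ k < n, T k ≤ t) (h2 : t < T n) : ringsUpTo T t = n := by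
  refine le_antisymm (Nat.sInf_le h2) (not_lt.1 fun h => ?_)
  have := Nat.sInf_mem (s := {n | t < T n}) ⟨n, h2⟩
  exact (h1 _ h).not_gt this

theorem ringsBefore_apply {T : ℕ → ℝ≥0} (hT : StrictMono T) (n : ℕ) :
    ringsBefore T (T n) = n :=
  ringsBefore_eq (fun _ h => hT h) le_rfl

/-- The state of `b.1` after `b.2` arrivals is determined by the last update of `b.1`, and thus by
the states `a` of the vertices in `N b.1` just before this update. -/
def Influences (N : V → Finset V) (T : V → ℕ → ℝ≥0) (a b : V × ℕ) : Prop :=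
  ∃ m, b.2 = m + 1 ∧ a.1 ∈ N b.1 ∧ a.2 = ringsBefore (T a.1) (T b.1 m)

/-- The properties of typical arrival times `T`. -/
structure IsRegularClock (N : V → Finset V) (T : V → ℕ → ℝ≥0) : Prop where
  pos : ∀ v n, 0 < T v n
  strictMono : ∀ v, StrictMono (T v)
  tendsto : ∀ v, Tendsto (T v) atTop atTop
  wf : WellFounded (Influences N T)

/-- Update times along an infinite backward chain strictly decrease, so they converge and eventually
lie in one `I j`. Each vertex has finitely many arrivals before the first of these times, so it
recurs finitely often, and loop erasure gives a forbidden path. -/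
theorem wellFounded_influences {N : V → Finset V} {T : V → ℕ → ℝ≥0} {J : Type*} {I : J → Set ℝ≥0}
    (hT : ∀ v, Tendsto (T v) atTop atTop) (hI : ∀ s, ∃ j, I j ∈ 𝓝 s)
    (hpath : ∀ j, ∀ g : ℕ → V, Function.Injective g → (∀ i, g (i + 1) ∈ N (g i)) →
      ∃ i, ¬ ∃ n, T (g i) n ∈ I j) :
    WellFounded (Influences N T) := by
  rw [wellFounded_iff_isEmpty_descending_chain]
  refine ⟨fun ⟨f, hf⟩ => ?_⟩
  choose m hm hN hb using hf
  let t : ℕ → ℝ≥0 := fun i => T (f i).1 (m i)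
  have hanti : StrictAnti t := strictAnti_nat_of_succ_lt fun i => by
    refine lt_of_lt_ringsBefore (T := T (f (i + 1)).1) ?_
    rw [← hb i, hm (i + 1)]
    exact Nat.lt_succ_self _
  obtain ⟨j, hj⟩ := hI (⨅ i, t i)
  obtain ⟨i₀, hi₀⟩ := eventually_atTop.1
    ((tendsto_atTop_ciInf hanti.antitone (OrderBot.bddBelow _)).eventually hj)
  have hfin : ∀ u, {i | (f (i₀ + i)).1 = u}.Finite := by
    intro u
    obtain ⟨M, hM⟩ := eventually_atTop.1 ((hT u).eventually_gt_atTop (t 0))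
    refine Set.Finite.of_finite_image (f := fun i => m (i₀ + i))
      ((Set.finite_lt_nat M).subset ?_) ?_
    · rintro _ ⟨i, hi, rfl⟩
      by_contra h
      simp only [mem_ofPred_eq, not_lt] at h hi
      have h1 := hM _ h
      rw [← hi] at h1
      exact h1.not_ge (hanti.antitone (Nat.zero_le (i₀ + i)))
    · intro i hi k hk h
      simp only [mem_ofPred_eq] at hi hk h
      have : t (i₀ + i) = t (i₀ + k) := by simp only [t, hi, hk, h]
      exact Nat.add_left_cancel (hanti.injective this)
  obtain ⟨φ, hφ, hstep⟩ := exists_injective_subwalk (r := fun x y => y ∈ N x)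
    (fun i => (f (i₀ + i)).1) hfin (fun i => hN (i₀ + i))
  obtain ⟨i, hi⟩ := hpath j _ hφ hstep
  exact hi ⟨_, hi₀ (i₀ + φ i) (Nat.le_add_right _ _)⟩

/-- The arrival times of all clocks as functions of the interarrival times. -/
noncomputable abbrev ringTime (ξ : V × ℕ → ℝ) (v : V) : ℕ → ℝ≥0 :=
  renewalTime fun k => ξ (v, k)

theorem ae_isRegularClock [Countable V] {N : V → Finset V} {K : ℕ} (hN : ∀ v, (N v).card ≤ K) :
    ∀ᵐ ξ ∂clocksMeasure V, IsRegularClock N (ringTime ξ) := by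
  have hclock : ∀ v, MeasurePreserving (fun (ξ : V × ℕ → ℝ) k => ξ (v, k))
      (clocksMeasure V) clockMeasure := fun v =>
    measurePreserving_infinitePi_comp _ fun _ _ h => (Prod.ext_iff.1 h).2
  have hpos : ∀ᵐ ξ ∂clocksMeasure V, ∀ v k, 0 < ξ (v, k) :=
    ae_all_iff.2 fun v => (hclock v).quasiMeasurePreserving.ae ae_clockMeasure_pos
  have htend : ∀ᵐ ξ ∂clocksMeasure V, ∀ v, Tendsto (ringTime ξ v) atTop atTop :=
    ae_all_iff.2 fun v => (hclock v).quasiMeasurePreserving.ae ae_tendsto_renewalTime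
  -- Ringing probability at most `1 / (K + 1)` is subcritical for `K` successors. Countably many
  -- such neighbourhoods cover the time axis, so the exceptional null sets can be united.
  have hε : (0 : ENNReal) < ((K : ENNReal) + 1)⁻¹ := by simp
  choose I hI hIm hIle using fun s => exists_nhds_clockMeasure_le s hε
  choose O hO hOo hOs using fun s => mem_nhds_iff.1 (hI s)
  obtain ⟨D, hD, hcover⟩ := TopologicalSpace.countable_cover_nhds
    fun s => (hOo s).mem_nhds (hOs s)
  have : Countable D := hD.to_subtype
  have hpath : ∀ᵐ ξ ∂clocksMeasure V, ∀ s : D, ∀ g : ℕ → V, Function.Injective g →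
      (∀ i, g (i + 1) ∈ N (g i)) → ∃ i, (fun k => ξ (g i, k)) ∉
        {ζ : ℕ → ℝ | ∃ n, renewalTime ζ n ∈ I s} := by
    refine ae_all_iff.2 fun s => ae_no_infinite_open_path hN ?_ ?_
    · have : {ζ : ℕ → ℝ | ∃ n, renewalTime ζ n ∈ I s} =
          ⋃ n, (fun ζ => renewalTime ζ n) ⁻¹' I s := by ext; simp
      rw [this]
      exact MeasurableSet.iUnion fun n => measurable_renewalTime n (hIm s)
    · calc (K : ENNReal) * clockMeasure {ζ : ℕ → ℝ | ∃ n, renewalTime ζ n ∈ I s}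
          ≤ K * ((K : ENNReal) + 1)⁻¹ := by gcongr; exact hIle s
        _ < 1 := by
          rw [← div_eq_mul_inv]
          refine ENNReal.div_lt_of_lt_mul ?_
          rw [one_mul]
          exact ENNReal.lt_add_right (ENNReal.natCast_ne_top K) one_ne_zero
  filter_upwards [hpos, htend, hpath] with ξ h1 h2 h3
  refine ⟨fun v n => ?_, fun v => strictMono_renewalTime (h1 v), h2, wellFounded_influences h2
    (I := fun s : D => I s) (fun s => ?_) h3⟩
  · exact Finset.sum_pos (fun k _ => Real.toNNReal_pos.2 (h1 v k)) ⟨0, by simp⟩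
  · obtain ⟨r, hr, hs⟩ := mem_iUnion₂.1 (hcover ▸ mem_univ s)
    exact ⟨⟨r, hr⟩, mem_of_superset ((hOo r).mem_nhds hs) (hO r)⟩

end Dependency

instance instMeasurableSingletonClassIntUnits : MeasurableSingletonClass ℤˣ where
  measurableSet_singleton x :=
    ⟨{(x : ℤ)}, measurableSet_singleton _, by ext y; simp [Units.ext_iff]⟩

/-! ### Recursive solution of the graphical construction -/

section SpinState

variable {V : Type*}

/-- The rates `c t v η` depend on `η` only through its restriction to `N v`. -/
def DependsOnNeighbors (c : ℝ≥0 → V → SpinConfig V → ℝ) (N : V → Finset V) : Prop :=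
  ∀ t v η ξ, (∀ u ∈ N v, η u = ξ u) → c t v η = c t v ξ

/-- The spin at `v` after an update at time `t` with the uniform variable `u`, which is first
transformed by `ρ (η v)`. -/
noncomputable def spinUpdate (c : ℝ≥0 → V → SpinConfig V → ℝ) (ρ : ℤˣ → unitInterval → unitInterval)
    (t : ℝ≥0) (v : V) (u : unitInterval) (η : SpinConfig V) : ℤˣ :=
  if (ρ (η v) u : ℝ) < c t v η then -η v else η v

open Classical in
/-- The spins in `N v` just before time `t`, when `S (u, n)` is the spin at `u` after `n`
arrivals; all other spins are set to `1`. -/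
noncomputable def localConfig (N : V → Finset V) (T : V → ℕ → ℝ≥0) (S : V × ℕ → ℤˣ) (v : V)
    (t : ℝ≥0) : SpinConfig V :=
  fun u => if u ∈ N v then S (u, ringsBefore (T u) t) else 1

variable (c : ℝ≥0 → V → SpinConfig V → ℝ) (ρ : ℤˣ → unitInterval → unitInterval)
  {N : V → Finset V} {T : V → ℕ → ℝ≥0} (hT : IsRegularClock N T)
  (η₀ : SpinConfig V) (U : V × ℕ → unitInterval)

open Classical in
/-- The spin at `b.1` after `b.2` arrivals in the graphical construction. -/
noncomputable def spinState : V × ℕ → ℤˣ :=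
  hT.wf.fix fun b rec => match b, rec with
    | (v, 0), _ => η₀ v
    | (v, m + 1), rec => spinUpdate c ρ (T v m) v (U (v, m)) fun u =>
        if h : u ∈ N v then rec (u, ringsBefore (T u) (T v m)) ⟨m, rfl, h, rfl⟩ else 1

theorem spinState_zero (v : V) : spinState c ρ hT η₀ U (v, 0) = η₀ v := by
  rw [spinState, WellFounded.fix_eq]

theorem spinState_succ (v : V) (m : ℕ) :
    spinState c ρ hT η₀ U (v, m + 1) = spinUpdate c ρ (T v m) v (U (v, m))
      (localConfig N T (spinState c ρ hT η₀ U) v (T v m)) := by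
  conv_lhs => rw [spinState, WellFounded.fix_eq]
  congr 1

variable {c ρ η₀}

theorem influences_of_mem {v u : V} (hu : u ∈ N v) (m : ℕ) :
    Influences N T (u, ringsBefore (T u) (T v m)) (v, m + 1) :=
  ⟨m, rfl, hu, rfl⟩

theorem localConfig_self {v : V} (hv : v ∈ N v) (hmono : StrictMono (T v)) (S : V × ℕ → ℤˣ)
    (m : ℕ) : localConfig N T S v (T v m) v = S (v, m) := by
  rw [localConfig, if_pos hv, ringsBefore_apply hmono]

theorem measurable_spinUpdate (hc : DependsOnNeighbors c N) (hρ : ∀ s, Measurable (ρ s))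
    {Ω : Type*} [MeasurableSpace Ω] (t : ℝ≥0) (v : V) {u : Ω → unitInterval}
    {η : Ω → SpinConfig V} (hu : Measurable u) (hη : Measurable η) :
    Measurable fun ω => spinUpdate c ρ t v (u ω) (η ω) := by
  classical
  have h1 : Measurable fun ω => c t v (η ω) := by
    -- The rate factors through the finite set of local configurations, where every function is
    -- measurable.
    let f : (N v → ℤˣ) → ℝ := fun r => c t v fun x => if h : x ∈ N v then r ⟨x, h⟩ else 1
    have hf : (fun ω => c t v (η ω)) = f ∘ fun ω (x : N v) => η ω x := by
      funext ω
      exact hc _ _ _ _ fun x hx => by simp [hx]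
    rw [hf]
    exact (measurable_of_finite f).comp (by fun_prop)
  have h2 : Measurable fun ω => ρ (η ω v) (u ω) := by
    have : Measurable fun z : ℤˣ × unitInterval => ρ z.1 z.2 :=
      measurable_from_prod_countable_right hρ
    exact this.comp (Measurable.prodMk (by fun_prop) hu)
  have h3 : Measurable fun s : ℤˣ => -s := measurable_of_finite _
  exact Measurable.ite (measurableSet_lt h2.subtype_val h1) (h3.comp (by fun_prop)) (by fun_prop)

theorem measurable_spinState (hc : DependsOnNeighbors c N) (hρ : ∀ s, Measurable (ρ s))
    (b : V × ℕ) : Measurable fun U => spinState c ρ hT η₀ U b := by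
  induction b using hT.wf.induction with
  | _ b ih =>
    obtain ⟨v, _ | m⟩ := b
    · simp only [spinState_zero]
      exact measurable_const
    · simp only [spinState_succ]
      refine measurable_spinUpdate hc hρ _ _ (by fun_prop) (measurable_pi_lambda _ fun u => ?_)
      unfold localConfig
      split_ifs with hu
      · exact ih _ (influences_of_mem hu m)
      · exact measurable_const

/-- The spin at `v` after the arrival at time `T v m` is determined by the uniform variables of the
arrivals up to this time. -/
theorem spinState_congr {U U' : V × ℕ → unitInterval} (b : V × ℕ)
    (h : ∀ m, b.2 = m + 1 → ∀ e : V × ℕ, T e.1 e.2 ≤ T b.1 m → U e = U' e) :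
    spinState c ρ hT η₀ U b = spinState c ρ hT η₀ U' b := by
  induction b using hT.wf.induction with
  | _ b ih =>
    obtain ⟨v, _ | m⟩ := b
    · simp only [spinState_zero]
    · have hl : localConfig N T (spinState c ρ hT η₀ U) v (T v m) =
          localConfig N T (spinState c ρ hT η₀ U') v (T v m) := by
        funext u
        unfold localConfig
        split_ifs with hu
        · refine ih _ (influences_of_mem hu m) fun k hk e he => h m rfl e (he.trans ?_)
          exact (lt_of_lt_ringsBefore (T := T u) ((Nat.lt_succ_self k).trans_eq hk.symm)).le
        · rfl
      rw [spinState_succ, spinState_succ, hl, h m rfl (v, m) le_rfl]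

end SpinState

/-! ### Uniqueness of Harris paths -/

section HarrisPath

variable {V : Type*} {c : ℝ≥0 → V → SpinConfig V → ℝ} {N : V → Finset V}

/-- This matches the left limit in the jump rule with the arrival count used in `localConfig`. -/
theorem eventually_ringsUpTo_eq {T : ℕ → ℝ≥0} (hT : Tendsto T atTop atTop) {t : ℝ≥0} :
    ∀ᶠ s in 𝓝[<] t, ringsUpTo T s = ringsBefore T t := by
  have h1 : ∀ᶠ s in 𝓝[<] t, ∀ k ∈ Finset.range (ringsBefore T t), T k ≤ s :=
    (Finset.eventually_all _).2 fun k hk => by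
      filter_upwards [nhdsWithin_le_nhds
        (lt_mem_nhds (lt_of_lt_ringsBefore (Finset.mem_range.1 hk)))] with s hs using hs.le
  filter_upwards [h1, self_mem_nhdsWithin] with s hs hst
  exact ringsUpTo_eq (fun k hk => hs k (Finset.mem_range.2 hk))
    (lt_of_lt_of_le hst (le_ringsBefore hT t))

/-- A trajectory of the graphical construction is determined by the driving data. -/
theorem IsHarrisPath.eq_spinState {d : HarrisData V} {x : ℝ≥0 → SpinConfig V}
    (hx : IsHarrisPath c d x) (hc : DependsOnNeighbors c N) (hN : ∀ v, v ∈ N v)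
    (hT : IsRegularClock N (ringTime d.2.1)) (t : ℝ≥0) (v : V) :
    x t v = spinState c (fun _ u => u) hT d.1 d.2.2 (v, ringsUpTo (ringTime d.2.1 v) t) := by
  suffices h : ∀ b : V × ℕ, ∀ t, ringsUpTo (ringTime d.2.1 b.1) t = b.2 →
      x t b.1 = spinState c (fun _ u => u) hT d.1 d.2.2 b from h (v, _) t rfl
  intro b
  induction b using hT.wf.induction with
  | _ b ih =>
    obtain ⟨v, _ | m⟩ := b
    · intro t ht
      rw [spinState_zero, hx.const v 0 t zero_le, hx.init]
      · rfl
      · rintro n ⟨-, hn⟩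
        have h1 := lt_ringsUpTo (hT.tendsto v) t
        rw [ht] at h1
        exact (h1.trans_le ((hT.strictMono v).monotone (Nat.zero_le n))).not_ge hn
    · intro t ht
      simp only at ht
      have hle : ringTime d.2.1 v m ≤ t :=
        le_of_lt_ringsUpTo (T := ringTime d.2.1 v) (ht ▸ Nat.lt_succ_self m)
      have hlt : t < ringTime d.2.1 v (m + 1) := ht ▸ lt_ringsUpTo (hT.tendsto v) t
      have h1 : x t v = x (ringTime d.2.1 v m) v := by
        refine hx.const v _ t hle ?_
        rintro n ⟨hn1, hn2⟩
        have := (hT.strictMono v).lt_iff_lt.1 hn1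
        have := (hT.strictMono v).lt_iff_lt.1 (lt_of_le_of_lt hn2 hlt)
        omega
      obtain ⟨η, hη, hjump⟩ := hx.jump v m
      have hne : (𝓝[<] (d.arrival v m)).NeBot :=
        nhdsLT_neBot_of_exists_lt ⟨0, hT.pos v m⟩
      have h2 : ∀ u ∈ N v, η u = localConfig N (ringTime d.2.1)
          (spinState c (fun _ u => u) hT d.1 d.2.2) v (ringTime d.2.1 v m) u := by
        intro u hu
        have h3 : ∀ᶠ s in 𝓝[<] (d.arrival v m), x s u = η u := by
          have := ((continuous_apply u).tendsto η).comp hη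
          rw [nhds_discrete, tendsto_pure] at this
          exact this
        obtain ⟨s, hs1, hs2⟩ := (h3.and (eventually_ringsUpTo_eq (hT.tendsto u))).exists
        rw [← hs1, localConfig, if_pos hu]
        exact ih _ (influences_of_mem hu m) s hs2
      rw [h1, spinState_succ, spinUpdate]
      have h4 := h2 v (hN v)
      rw [← h4, ← hc (ringTime d.2.1 v m) v _ _ h2]
      exact hjump

end HarrisPath

/-! ### Invariance of the law under reflection -/

section Reflection

/-- The reflection of a uniform variable which turns the given dynamics into a monotone one. -/
def reflect (s : ℤˣ) (u : unitInterval) : unitInterval := if s = 1 then unitInterval.symm u else u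

theorem measurable_reflect (s : ℤˣ) : Measurable (reflect s) := by
  unfold reflect
  split_ifs
  · exact unitInterval.measurable_symm
  · exact measurable_id

theorem reflect_reflect (s : ℤˣ) (u : unitInterval) : reflect s (reflect s u) = u := by
  unfold reflect
  split_ifs <;> simp

theorem measurePreserving_reflect (s : ℤˣ) : MeasurePreserving (reflect s) volume volume := by
  by_cases hs : s = 1
  · have : reflect s = unitInterval.symm := by funext u; simp [reflect, hs]
    rw [this]
    exact unitInterval.measurePreserving_symm
  · have : reflect s = id := by funext u; simp [reflect, hs]
    rw [this]
    exact MeasurePreserving.id _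

variable {V : Type*} (c : ℝ≥0 → V → SpinConfig V → ℝ)
  {N : V → Finset V} {T : V → ℕ → ℝ≥0} (hT : IsRegularClock N T) (η₀ : SpinConfig V)

/-- The uniform variables reflected according to the spin they are applied to. -/
noncomputable def reflectedUniforms (U : V × ℕ → unitInterval) : V × ℕ → unitInterval :=
  fun e => reflect (spinState c (fun _ u => u) hT η₀ U e) (U e)

/-- Inductively both dynamics have the same spin before each update, so the two reflections cancel.
-/
theorem spinState_reflectedUniforms (hN : ∀ v, v ∈ N v) (U : V × ℕ → unitInterval) (b : V × ℕ) :
    spinState c reflect hT η₀ (reflectedUniforms c hT η₀ U) b =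
      spinState c (fun _ u => u) hT η₀ U b := by
  induction b using hT.wf.induction with
  | _ b ih =>
    obtain ⟨v, _ | m⟩ := b
    · simp only [spinState_zero]
    · have hl : localConfig N T (spinState c reflect hT η₀ (reflectedUniforms c hT η₀ U)) v (T v m) =
          localConfig N T (spinState c (fun _ u => u) hT η₀ U) v (T v m) := by
        funext u
        unfold localConfig
        split_ifs with hu
        · exact ih _ (influences_of_mem hu m)
        · rfl
      rw [spinState_succ, spinState_succ, hl, spinUpdate, spinUpdate, localConfig_self (hN v) (hT.strictMono v),
        reflectedUniforms, reflect_reflect]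

variable {c}

theorem measurable_reflectedUniforms [Countable V] (hc : DependsOnNeighbors c N) :
    Measurable (reflectedUniforms c hT η₀) := by
  refine measurable_pi_lambda _ fun e => ?_
  have : Measurable fun z : ℤˣ × unitInterval => reflect z.1 z.2 :=
    measurable_from_prod_countable_right measurable_reflect
  exact this.comp ((measurable_spinState hT hc (fun _ => measurable_id) e).prodMk
    (measurable_pi_apply e))

theorem spinState_update_of_le [DecidableEq V] (U : V × ℕ → unitInterval) (u : unitInterval)
    {e b : V × ℕ} (h : T b.1 b.2 ≤ T e.1 e.2) :
    spinState c (fun _ u => u) hT η₀ (Function.update U e u) b =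
      spinState c (fun _ u => u) hT η₀ U b := by
  refine spinState_congr hT b fun m hm e' he' => ?_
  refine Function.update_of_ne ?_ _ _
  rintro rfl
  exact (he'.trans_lt (hT.strictMono b.1 (hm ▸ Nat.lt_succ_self m))).not_ge h

/-- Resample the uniform variable of the latest arrival `e` in a finite set. The spin just before
`e` and the reflected variables of the other arrivals in the set do not depend on it, and each
reflection preserves Lebesgue measure, so one factor splits off. -/
theorem measurePreserving_reflectedUniforms [Countable V] (hc : DependsOnNeighbors c N) :
    MeasurePreserving (reflectedUniforms c hT η₀)
      (Measure.infinitePi fun _ : V × ℕ => (volume : Measure unitInterval))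
      (Measure.infinitePi fun _ : V × ℕ => (volume : Measure unitInterval)) where
  measurable := measurable_reflectedUniforms hT η₀ hc
  map_eq := by
    classical
    have hm := measurable_reflectedUniforms hT η₀ hc
    refine Measure.eq_infinitePi _ fun s t ht => ?_
    have hs : ∀ s : Finset (V × ℕ), MeasurableSet ((s : Set (V × ℕ)).pi t) := fun s =>
      .pi s.countable_toSet fun _ _ => ht _
    rw [Measure.map_apply hm (hs s)]
    induction s using Finset.induction_on_max_value (fun e : V × ℕ => T e.1 e.2) with
    | empty => simp
    | insert e s he hmax ih =>
      rw [infinitePi_eq_lintegral_update _ e (hm (hs _)), Finset.prod_insert he, ← ih,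
        ← setLIntegral_const, ← lintegral_indicator (hm (hs s))]
      refine lintegral_congr fun U => ?_
      have h1 : ∀ u, reflectedUniforms c hT η₀ (Function.update U e u) e =
          reflect (spinState c (fun _ u => u) hT η₀ U e) u := fun u => by
        rw [reflectedUniforms, spinState_update_of_le hT η₀ U u le_rfl, Function.update_self]
      have h2 : ∀ u, ∀ b ∈ s, reflectedUniforms c hT η₀ (Function.update U e u) b =
          reflectedUniforms c hT η₀ U b := fun u b hb => by
        rw [reflectedUniforms, spinState_update_of_le hT η₀ U u (hmax b hb),
          Function.update_of_ne (ne_of_mem_of_not_mem hb he), reflectedUniforms]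
      have h3 : {u | Function.update U e u ∈
            reflectedUniforms c hT η₀ ⁻¹' ((insert e s : Finset (V × ℕ)) : Set (V × ℕ)).pi t} =
          {u | reflect (spinState c (fun _ u => u) hT η₀ U e) u ∈ t e ∧
            U ∈ reflectedUniforms c hT η₀ ⁻¹' (s : Set (V × ℕ)).pi t} := by
        ext u
        simp only [mem_ofPred_eq, mem_preimage, Finset.coe_insert, Set.insert_pi, mem_inter_iff,
          Function.eval, h1]
        refine and_congr_right fun _ => forall₂_congr fun b hb => ?_
        rw [h2 u b hb]
      rw [h3]
      by_cases hU : U ∈ reflectedUniforms c hT η₀ ⁻¹' (s : Set (V × ℕ)).pi t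
      · rw [indicator_of_mem hU]
        simp only [hU, and_true]
        exact (measurePreserving_reflect _).measure_preimage (ht e).nullMeasurableSet
      · rw [indicator_of_notMem hU]
        simp [hU]

end Reflection

/-! ### Monotone coupling and deletion of an arrival -/

section Monotonicity

variable {V : Type*} {c : ℝ≥0 → V → SpinConfig V → ℝ}

theorem spinUpdate_reflect_mono (hc : IsGlauberRate c) (hattr : IsAttractive c) (t : ℝ≥0) (v : V)
    (u : unitInterval) {η η' : SpinConfig V} (h : η ≤ η') :
    spinUpdate c reflect t v u η ≤ spinUpdate c reflect t v u η' := by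
  classical
  have hle : (-1 : ℤˣ) ≤ 1 := by decide
  have hne : (-1 : ℤˣ) ≠ 1 := by decide
  have hv := h v
  unfold spinUpdate
  rcases Int.units_eq_one_or (η v) with h1 | h1 <;> rcases Int.units_eq_one_or (η' v) with h2 | h2
  · have := hattr.anti t v η η' h h1 h2
    rw [h1, h2]
    split_ifs with h3 h4 h4
    · exact le_rfl
    · exact hle
    · exact absurd (h4.trans_le this) h3
    · exact le_rfl
  · rw [h1, h2] at hv
    exact absurd hv (show ¬ (1 : ℤˣ) ≤ -1 by decide)
  -- The order could fail only if both spins flip or both stay. Only the former reverses it, and it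
  -- would give `u < c t v η ≤ c t v (η'.flip v) < u`.
  · have h3 : η ≤ η'.flip v := by
      intro x
      by_cases hx : x = v
      · subst hx
        simp [SpinConfig.flip, h1, h2]
      · simpa [SpinConfig.flip, hx] using h x
    have h4 := hattr.mono t v η _ h3 h1 (by simp [SpinConfig.flip, h2])
    have h5 := hc.glauber t v η'
    rw [h1, h2]
    simp only [reflect, if_neg hne, if_true, unitInterval.coe_symm_eq, neg_neg]
    split_ifs with h6 h7 h7
    · linarith
    · exact le_rfl
    · exact le_rfl
    · exact hle
  · have := hattr.mono t v η η' h h1 h2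
    rw [h1, h2]
    split_ifs with h3 h4 h4
    · exact le_rfl
    · exact absurd (h3.trans_le this) h4
    · exact hle
    · exact le_rfl

open Classical in
/-- The number `1` at `w` and `0` elsewhere. -/
noncomputable def skip (w v : V) : ℕ := if v = w then 1 else 0

theorem ringsBefore_add {T : ℕ → ℝ≥0} (hT : StrictMono T) (htop : Tendsto T atTop atTop) (j : ℕ)
    (t : ℝ≥0) : ringsBefore (fun n => T (n + j)) t = ringsBefore T t - j :=
  ringsBefore_eq (fun k hk => lt_of_lt_ringsBefore (by omega))
    ((le_ringsBefore htop t).trans (hT.monotone (by omega)))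

variable {N : V → Finset V} {T T' : V → ℕ → ℝ≥0}

/-- Removing the first arrival at `w` and setting the initial spin at `w` to `1` increases the spins
in the monotone dynamics. -/
theorem spinState_le_spinState_skip (hc : IsGlauberRate c) (hattr : IsAttractive c)
    (hT : IsRegularClock N T) (hT' : IsRegularClock N T') {w : V}
    (hTT' : ∀ v n, T' v n = T v (n + skip w v)) {η₀ η₀' : SpinConfig V} (hη : η₀ ≤ η₀')
    (hw : η₀' w = 1) {U U' : V × ℕ → unitInterval} (hU : ∀ v n, U' (v, n) = U (v, n + skip w v))
    (b : V × ℕ) :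
    spinState c reflect hT η₀ U b ≤ spinState c reflect hT' η₀' U' (b.1, b.2 - skip w b.1) := by
  have hle : (-1 : ℤˣ) ≤ 1 := by decide
  induction b using hT.wf.induction with
  | _ b ih =>
    obtain ⟨v, _ | m⟩ := b
    · simp only [spinState_zero, Nat.zero_sub]
      exact hη v
    · rcases lt_or_ge m (skip w v) with hm | hm
      -- This is the deleted arrival: `m = 0` at `w`, and the modified spin is still its initial
      -- value `1`, the maximum.
      · have hv : v = w := by
          by_contra hv
          simp [skip, hv] at hm
        have h0 : m + 1 - skip w v = 0 := by omega
        subst hv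
        simp only [h0]
        rw [spinState_zero, hw]
        rcases Int.units_eq_one_or (spinState c reflect hT η₀ U (v, m + 1)) with h | h
        · exact h.le
        · exact h.trans_le hle
      · obtain ⟨k, rfl⟩ := Nat.exists_eq_add_of_le' hm
        have h0 : k + skip w v + 1 - skip w v = k + 1 := by omega
        simp only [h0, spinState_succ, hU, hTT']
        refine spinUpdate_reflect_mono hc hattr _ _ _ fun u => ?_
        unfold localConfig
        split_ifs with hu
        · have h1 : ringsBefore (T' u) (T v (k + skip w v)) =
              ringsBefore (T u) (T v (k + skip w v)) - skip w u := by
            rw [← ringsBefore_add (hT.strictMono u) (hT.tendsto u)]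
            congr 1
            funext n
            exact hTT' u n
          rw [h1]
          exact ih _ (influences_of_mem hu _)
        · exact le_rfl

end Monotonicity

/-! ### Absolute continuity of the deletion -/

section Merge

variable {V : Type*}

open Classical in
/-- The interarrival times after removing the first arrival of the clock of `w`. -/
noncomputable def mergeFirst (w : V) (ξ : V × ℕ → ℝ) : V × ℕ → ℝ :=
  fun e => if e = (w, 0) then ξ (w, 0) + ξ (w, 1) else ξ (e.1, e.2 + skip w e.1)

theorem renewalTime_merge {ζ : ℕ → ℝ} (h : ∀ k, 0 < ζ k) (n : ℕ) :
    renewalTime (fun k => if k = 0 then ζ 0 + ζ 1 else ζ (k + 1)) n = renewalTime ζ (n + 1) := by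
  induction n with
  | zero =>
    simp [renewalTime, Finset.sum_range_succ, Real.toNNReal_add (h 0).le (h 1).le]
  | succ n ih =>
    rw [renewalTime, Finset.sum_range_succ, ← renewalTime, ih, renewalTime, renewalTime,
      Finset.sum_range_succ _ (n + 1 + 1)]
    simp

theorem ringTime_mergeFirst {ξ : V × ℕ → ℝ} (h : ∀ e, 0 < ξ e) (w v : V) (n : ℕ) :
    ringTime (mergeFirst w ξ) v n = ringTime ξ v (n + skip w v) := by
  by_cases hv : v = w
  · subst hv
    simp only [skip, if_true]
    rw [ringTime, ringTime, ← renewalTime_merge fun k => h (v, k)]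
    congr 1
    funext k
    simp [mergeFirst, skip]
  · simp only [skip, hv, if_false, add_zero]
    rw [ringTime, ringTime]
    congr 1
    funext k
    simp [mergeFirst, skip, hv]

theorem measurable_mergeFirst (w : V) : Measurable (mergeFirst w) := by
  refine measurable_pi_lambda _ fun e => ?_
  unfold mergeFirst
  split_ifs <;> fun_prop

-- Apart from the first interarrival time at `w`, the merged family is a relabelled i.i.d. family.
-- That time becomes a positive constant plus an exponential variable, and a positive shift of the
-- exponential law is absolutely continuous with respect to it.
open Classical in
theorem quasiMeasurePreserving_mergeFirst (w : V) :
    Measure.QuasiMeasurePreserving (mergeFirst w) (clocksMeasure V) (clocksMeasure V) := by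
  refine ⟨measurable_mergeFirst w, Measure.AbsolutelyContinuous.mk fun s hs h0 => ?_⟩
  -- The first interarrival time at `w` becomes the extra variable; those remaining at `w` shift
  -- down by one.
  let j : V × ℕ → Option (V × ℕ) := fun e => if e = (w, 0) then none else some (e.1, e.2 - skip w e.1)
  have hj : Function.Injective j := by
    rintro ⟨v, n⟩ ⟨v', n'⟩ h
    by_cases h1 : (v, n) = (w, 0) <;> by_cases h2 : (v', n') = (w, 0)
    · rw [h1, h2]
    · simp [j, h1, h2] at h
    · simp [j, h1, h2] at h
    · simp only [j, h1, h2, if_false, Option.some.injEq, Prod.mk.injEq] at h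
      obtain ⟨rfl, h⟩ := h
      by_cases hv : v = w
      · subst hv
        simp only [Prod.mk.injEq, true_and, skip, if_true] at h1 h2 h
        have : n = n' := by omega
        rw [this]
      · simp only [skip, hv, if_false] at h
        have : n = n' := by omega
        rw [this]
  have hQ := measurePreserving_prod_infinitePi (expMeasure 1) hj
  have hmerge : ∀ (b : ℝ) (ζ : V × ℕ → ℝ),
      mergeFirst w (fun e => (j e).elim b ζ) = Function.update ζ (w, 0) (ζ (w, 0) + b) := by
    intro b ζ
    funext ⟨v, n⟩
    by_cases h1 : (v, n) = (w, 0)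
    · rw [h1]
      simp [mergeFirst, j, skip, add_comm]
    · rw [Function.update_of_ne h1, mergeFirst, if_neg h1]
      by_cases hv : v = w
      · simp [j, skip, hv]
      · simp [j, skip, hv]
  have hpos : ∀ᵐ ζ ∂clocksMeasure V, 0 < ζ (w, 0) :=
    (measurePreserving_eval_infinitePi (fun _ : V × ℕ => expMeasure 1) (w, 0)
      ).quasiMeasurePreserving.ae ae_expMeasure_pos
  have hupd : ∀ᵐ ζ ∂clocksMeasure V, ∀ᵐ b ∂expMeasure 1, Function.update ζ (w, 0) b ∉ s := by
    refine Measure.ae_ae_of_ae_prod (p := fun z : (V × ℕ → ℝ) × ℝ =>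
      Function.update z.1 (w, 0) z.2 ∉ s) ?_
    exact ((measurePreserving_update_infinitePi (expMeasure 1) (w, 0)).comp
      Measure.measurePreserving_swap).quasiMeasurePreserving.ae (measure_eq_zero_iff_ae_notMem.1 h0)
  have hm := measurable_mergeFirst w hs
  rw [Measure.map_apply (measurable_mergeFirst w) hs, ← hQ.measure_preimage hm.nullMeasurableSet,
    Measure.prod_apply_symm (hQ.measurable hm)]
  refine (lintegral_congr_ae ?_).trans lintegral_zero
  filter_upwards [hpos, hupd] with ζ h1 h2
  have h3 := ae_expMeasure_add h1.le h2
  refine measure_mono_null ?_ (ae_iff.1 h3)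
  intro b hb
  have hb' : mergeFirst w (fun e => (j e).elim b ζ) ∈ s := hb
  rw [hmerge] at hb'
  simpa [add_comm] using hb'

end Merge

/-! ### Descent to fixation from time zero -/

section Stays

variable {V : Type*} {c : ℝ≥0 → V → SpinConfig V → ℝ} {N : V → Finset V}

/-- The law of the uniform variables. -/
noncomputable abbrev uniformsMeasure (V : Type*) : Measure (V × ℕ → unitInterval) :=
  Measure.infinitePi fun _ : V × ℕ => volume

/-- The law of the initial configuration. -/
noncomputable abbrev initialMeasure (V : Type*) (p : unitInterval) : Measure (SpinConfig V) :=
  Measure.infinitePi fun _ : V => bernoulliMeasure (1 : ℤˣ) (-1) p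

/-- The spin at `w` is `1` from the `m`-th arrival on. -/
def StaysOne (c : ℝ≥0 → V → SpinConfig V → ℝ) (ρ : ℤˣ → unitInterval → unitInterval)
    {T : V → ℕ → ℝ≥0} (hT : IsRegularClock N T) (η₀ : SpinConfig V) (w : V) (m : ℕ)
    (U : V × ℕ → unitInterval) : Prop :=
  ∀ k, m ≤ k → spinState c ρ hT η₀ U (w, k) = 1

/-- The original and the monotone dynamics have the same law. -/
theorem ae_not_staysOne_reflect_iff [Countable V] (hc : DependsOnNeighbors c N)
    (hN : ∀ v, v ∈ N v) {T : V → ℕ → ℝ≥0} (hT : IsRegularClock N T) (η₀ : SpinConfig V) (w : V)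
    (m : ℕ) :
    (∀ᵐ U ∂uniformsMeasure V, ¬ StaysOne c reflect hT η₀ w m U) ↔
      ∀ᵐ U ∂uniformsMeasure V, ¬ StaysOne c (fun _ u => u) hT η₀ w m U := by
  have h := measurePreserving_reflectedUniforms hT η₀ hc
  have hm : MeasurableSet {U | ¬ StaysOne c reflect hT η₀ w m U} := by
    have : {U | StaysOne c reflect hT η₀ w m U} = ⋂ k, ⋂ (_ : m ≤ k),
        (fun U => spinState c reflect hT η₀ U (w, k)) ⁻¹' {1} := by
      ext; simp [StaysOne]
    refine MeasurableSet.compl (s := {U | StaysOne c reflect hT η₀ w m U}) ?_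
    rw [this]
    exact MeasurableSet.iInter fun k => MeasurableSet.iInter fun _ =>
      measurable_spinState hT hc measurable_reflect _ (measurableSet_singleton _)
  have h' := h.map_eq
  rw [uniformsMeasure]
  conv_lhs => rw [← h']
  rw [ae_map_iff h.measurable.aemeasurable hm]
  simp only [StaysOne, spinState_reflectedUniforms c hT η₀ hN]

/-- Null events pull back along the modification of the data. The almost-everywhere quantifiers are
iterated, so measurability of `spinState` is used only in `U`. -/
theorem ae_not_staysOne_succ [Countable V] (hc : IsGlauberRate c) (hattr : IsAttractive c)
    (hdep : DependsOnNeighbors c N) (hN : ∀ v, v ∈ N v) {K : ℕ} (hK : ∀ v, (N v).card ≤ K)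
    {p : unitInterval} (hp : 0 < p) (w : V) (m : ℕ)
    (h : ∀ᵐ η₀ ∂initialMeasure V p, ∀ᵐ ξ ∂clocksMeasure V, ∀ hT : IsRegularClock N (ringTime ξ),
      ∀ᵐ U ∂uniformsMeasure V, ¬ StaysOne c (fun _ u => u) hT η₀ w m U) :
    ∀ᵐ η₀ ∂initialMeasure V p, ∀ᵐ ξ ∂clocksMeasure V, ∀ hT : IsRegularClock N (ringTime ξ),
      ∀ᵐ U ∂uniformsMeasure V, ¬ StaysOne c (fun _ u => u) hT η₀ w (m + 1) U := by
  classical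
  have h1 := ae_ae_update_infinitePi (bernoulliMeasure (1 : ℤˣ) (-1) p) w h
  have h2 : ∀ᵐ η₀ ∂initialMeasure V p, ∀ᵐ ξ ∂clocksMeasure V,
      ∀ hT : IsRegularClock N (ringTime ξ), ∀ᵐ U ∂uniformsMeasure V,
        ¬ StaysOne c (fun _ u => u) hT (Function.update η₀ w 1) w m U := by
    -- The value `1` is an atom of mass `p > 0`, so a property of almost every resampled spin holds
    -- for it.
    by_contra hcon
    have h3 := measure_mono_null (singleton_subset_iff.2 hcon) (ae_iff.1 h1)
    rw [bernoulliMeasure_apply_of_mem_of_notMem _ (measurableSet_singleton _) (by simp)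
      (by simp)] at h3
    simp at h3
    exact hp.ne' (Subtype.ext (congrArg NNReal.toReal h3))
  have hpos : ∀ᵐ ξ ∂clocksMeasure V, ∀ e, 0 < ξ e := ae_all_iff.2 fun e =>
    (measurePreserving_eval_infinitePi (fun _ : V × ℕ => expMeasure 1) e
      ).quasiMeasurePreserving.ae ae_expMeasure_pos
  filter_upwards [h2] with η₀ h2
  have hmerge := quasiMeasurePreserving_mergeFirst w
  filter_upwards [hpos, hmerge.ae h2, hmerge.ae (ae_isRegularClock hK)] with ξ hξ h3 hT' hT
  have hskip : Function.Injective fun e : V × ℕ => (e.1, e.2 + skip w e.1) := by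
    rintro ⟨v, n⟩ ⟨v', n'⟩ h
    simp only [Prod.mk.injEq] at h
    obtain ⟨rfl, h⟩ := h
    rw [Nat.add_right_cancel h]
  rw [← ae_not_staysOne_reflect_iff hdep hN]
  have h4 := (measurePreserving_infinitePi_comp (volume : Measure unitInterval) hskip
    ).quasiMeasurePreserving.ae ((ae_not_staysOne_reflect_iff hdep hN _ _ _ _).2 (h3 hT'))
  filter_upwards [h4] with U hU hstay
  refine hU fun k hk => ?_
  have h5 := spinState_le_spinState_skip hc hattr hT hT' (w := w)
    (fun v n => ringTime_mergeFirst hξ w v n) (η₀ := η₀) (η₀' := Function.update η₀ w 1)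
    (fun v => ?_) (by simp) (U := U) (U' := fun e => U (e.1, e.2 + skip w e.1))
    (fun _ _ => rfl) (w, k + 1)
  · rw [hstay (k + 1) (by omega)] at h5
    simp only [skip, if_true, Nat.add_sub_cancel] at h5
    rcases Int.units_eq_one_or (spinState c reflect hT' (Function.update η₀ w 1)
      (fun e => U (e.1, e.2 + skip w e.1)) (w, k)) with h6 | h6
    · exact h6
    · exact absurd (h5.trans_eq h6) (show ¬ (1 : ℤˣ) ≤ -1 by decide)
  · by_cases hv : v = w
    · subst hv
      rw [Function.update_self]
      rcases Int.units_eq_one_or (η₀ v) with h6 | h6 <;> rw [h6]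
      exact (show (-1 : ℤˣ) ≤ 1 by decide)
    · rw [Function.update_of_ne hv]

/-- If the spin at `w` is almost surely not always `1`, then almost surely it is not eventually
`1`. -/
theorem ae_not_staysOne [Countable V] (hc : IsGlauberRate c) (hattr : IsAttractive c)
    (hdep : DependsOnNeighbors c N) (hN : ∀ v, v ∈ N v) {K : ℕ} (hK : ∀ v, (N v).card ≤ K)
    {p : unitInterval} (hp : 0 < p) (w : V)
    (h : ∀ᵐ η₀ ∂initialMeasure V p, ∀ᵐ ξ ∂clocksMeasure V, ∀ hT : IsRegularClock N (ringTime ξ),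
      ∀ᵐ U ∂uniformsMeasure V, ¬ StaysOne c (fun _ u => u) hT η₀ w 0 U) :
    ∀ᵐ η₀ ∂initialMeasure V p, ∀ᵐ ξ ∂clocksMeasure V, ∀ hT : IsRegularClock N (ringTime ξ),
      ∀ᵐ U ∂uniformsMeasure V, ∀ m, ¬ StaysOne c (fun _ u => u) hT η₀ w m U := by
  have hm : ∀ m, ∀ᵐ η₀ ∂initialMeasure V p, ∀ᵐ ξ ∂clocksMeasure V,
      ∀ hT : IsRegularClock N (ringTime ξ),
      ∀ᵐ U ∂uniformsMeasure V, ¬ StaysOne c (fun _ u => u) hT η₀ w m U := by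
    intro m
    induction m with
    | zero => exact h
    | succ m ih => exact ae_not_staysOne_succ hc hattr hdep hN hK hp w m ih
  filter_upwards [ae_all_iff.2 hm] with η₀ h1
  filter_upwards [ae_all_iff.2 h1] with ξ h2 hT
  exact ae_all_iff.2 fun m => h2 m hT

/-- An eventually constant trajectory of the graphical construction, observed along a dense set of
times, corresponds to an eventually constant sequence of states. -/
theorem exists_staysOne_of_dense {T : V → ℕ → ℝ≥0} (hT : IsRegularClock N T) {η₀ : SpinConfig V}
    {U : V × ℕ → unitInterval} {x : ℝ≥0 → SpinConfig V} {w : V}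
    (hx : ∀ t, x t w = spinState c (fun _ u => u) hT η₀ U (w, ringsUpTo (T w) t))
    {D : Set ℝ≥0} (hD : Dense D) {M : ℝ≥0} (h : ∀ q ∈ D, M ≤ q → x q w = 1) :
    ∃ m, StaysOne c (fun _ u => u) hT η₀ w m U := by
  obtain ⟨m, hm⟩ := eventually_atTop.1 ((hT.tendsto w).eventually_ge_atTop M)
  refine ⟨m + 1, fun k hk => ?_⟩
  obtain ⟨k, rfl⟩ := Nat.exists_eq_add_of_le' hk
  -- The state after `k + m + 1` arrivals is visible between arrivals `k + m` and `k + m + 1`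
  -- (counted from `0`), hence the witness `m + 1`.
  obtain ⟨q, hq, hq1, hq2⟩ := hD.exists_between (hT.strictMono w (Nat.lt_succ_self (k + m)))
  have h1 : ringsUpTo (T w) q = k + m + 1 := ringsUpTo_eq
    (fun j hj => ((hT.strictMono w).monotone (Nat.le_of_lt_succ hj)).trans hq1.le) hq2
  rw [← h q hq ((hm _ (Nat.le_add_left m k)).trans hq1.le), hx, h1, add_assoc]

theorem fixatesFromTimeZeroAt_of_dense {x : ℝ≥0 → SpinConfig V} {w : V}
    (hx : ∀ t, ContinuousWithinAt x (Ici t) t) {D : Set ℝ≥0} (hD : Dense D)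
    (h : ∀ q ∈ D, x q w = 1) : FixatesFromTimeZeroAt x w 1 := by
  have h1 : ∀ t, x t w = 1 := by
    intro t
    have h2 : ∀ᶠ s in 𝓝[≥] t, x s w = x t w := by
      have := ((continuous_apply w).tendsto (x t)).comp (hx t)
      rw [nhds_discrete, tendsto_pure] at this
      exact this
    obtain ⟨u, hu, hsub⟩ := (mem_nhdsGE_iff_exists_Ico_subset' (lt_add_one t)).1 h2
    obtain ⟨q, hq, hq1, hq2⟩ := hD.exists_between hu
    rw [← h q hq]
    exact (hsub ⟨hq1.le, hq2⟩).symm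
  refine ⟨?_, h1⟩
  rw [eq_empty_iff_forall_notMem]
  rintro t ⟨ht, hev⟩
  have : (𝓝[<] t).NeBot := nhdsLT_neBot_of_exists_lt ⟨0, ht⟩
  obtain ⟨s, hs⟩ := hev.exists
  rw [h1, h1] at hs
  exact absurd hs (by decide)

end Stays

theorem mainTheorem4 {V : Type*} [Countable V]
    (c : ℝ≥0 → V → SpinConfig V → ℝ)
    (hc : IsGlauberRate c) (hrange : HasBoundedRange c) (hattr : IsAttractive c)
    (p : unitInterval) (hp : 0 < p)
    {Ω : Type*} [MeasurableSpace Ω] (P : Measure Ω) [IsProbabilityMeasure P]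
    (σ : ℝ≥0 → Ω → SpinConfig V) (hσ : IsSpinSystem c p P σ)
    (w : V) (hw : 0 < P {ω | FixatesAt (fun t => σ t ω) w 1}) :
    0 < P {ω | FixatesFromTimeZeroAt (fun t => σ t ω) w 1} := by
  classical
  obtain ⟨A, ⟨K, hK⟩, hA⟩ := hrange
  let N : V → Finset V := fun v => insert v (A v)
  have hN : ∀ v, v ∈ N v := fun v => Finset.mem_insert_self _ _
  have hNK : ∀ v, (N v).card ≤ K + 1 := fun v =>
    (Finset.card_insert_le _ _).trans (Nat.succ_le_succ (hK v))
  have hdep : DependsOnNeighbors c N := fun t v η ξ h =>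
    hA t v η ξ fun u hu => h u (Finset.mem_insert_of_mem hu)
  obtain ⟨hrc, X, hX, hid⟩ := hσ
  obtain ⟨D, hDc, hD⟩ := TopologicalSpace.exists_countable_dense ℝ≥0
  have hev : ∀ q : ℝ≥0, MeasurableSet {x : ℝ≥0 → SpinConfig V | x q w = 1} := fun q =>
    (measurable_pi_apply w).comp (measurable_pi_apply q) (measurableSet_singleton 1)
  -- Restricting to a countable dense set of times makes these events measurable on path space;
  -- right-continuity recovers all times.
  let F₀ : Set (ℝ≥0 → SpinConfig V) := {x | ∀ q ∈ D, x q w = 1}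
  let F₁ : Set (ℝ≥0 → SpinConfig V) := {x | ∃ M : ℕ, ∀ q ∈ D, (M : ℝ≥0) ≤ q → x q w = 1}
  have hF₀ : MeasurableSet F₀ := by
    have : F₀ = ⋂ q ∈ D, {x | x q w = 1} := by ext; simp [F₀]
    rw [this]
    exact MeasurableSet.biInter hDc fun q _ => hev q
  have hF₁ : MeasurableSet F₁ := by
    have : F₁ = ⋃ M : ℕ, ⋂ q ∈ D, ⋂ (_ : (M : ℝ≥0) ≤ q), {x | x q w = 1} := by ext; simp [F₁]
    rw [this]
    exact MeasurableSet.iUnion fun M => MeasurableSet.biInter hDc fun q _ =>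
      MeasurableSet.iInter fun _ => hev q
  by_contra hcon
  have hP₀ : P ((fun ω t => σ t ω) ⁻¹' F₀) = 0 := by
    refine le_antisymm (le_trans (measure_mono_ae ?_) (not_lt.1 hcon)) zero_le
    filter_upwards [hrc] with ω hω h
    exact fixatesFromTimeZeroAt_of_dense hω hD h
  rw [hid.measure_mem_eq hF₀] at hP₀
  have hreg : ∀ᵐ d ∂harrisMeasure V p, IsRegularClock N (ringTime d.2.1) := by
    have h1 : Measure.QuasiMeasurePreserving (fun d : HarrisData V => d.2.1)
        (harrisMeasure V p) (clocksMeasure V) :=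
      Measure.quasiMeasurePreserving_fst.comp Measure.quasiMeasurePreserving_snd
    exact h1.ae (ae_isRegularClock hNK)
  have hzero : ∀ᵐ d ∂harrisMeasure V p, ∀ hT : IsRegularClock N (ringTime d.2.1),
      ¬ StaysOne c (fun _ u => u) hT d.1 w 0 d.2.2 := by
    filter_upwards [hX, measure_eq_zero_iff_ae_notMem.1 hP₀] with d hd h hT hstay
    exact h fun q _ => (hd.eq_spinState hdep hN hT q w).trans (hstay _ (Nat.zero_le _))
  have hzero' : ∀ᵐ η₀ ∂initialMeasure V p, ∀ᵐ ξ ∂clocksMeasure V,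
      ∀ hT : IsRegularClock N (ringTime ξ), ∀ᵐ U ∂uniformsMeasure V,
        ¬ StaysOne c (fun _ u => u) hT η₀ w 0 U := by
    filter_upwards [Measure.ae_ae_of_ae_prod hzero] with η₀ h1
    filter_upwards [Measure.ae_ae_of_ae_prod h1] with ξ h2 hT
    filter_upwards [h2] with U h3 using h3 hT
  have hall := ae_not_staysOne hc hattr hdep hN hNK hp w hzero'
  -- A measurable version of `X` makes the event measurable on the whole product, so iterated null
  -- statements combine by Fubini.
  obtain ⟨Y, hY, hXY⟩ := hid.aemeasurable_snd
  have hgood : ∀ᵐ d ∂harrisMeasure V p, IsRegularClock N (ringTime d.2.1) ∧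
      IsHarrisPath c d (Y d) := by
    filter_upwards [hreg, hX, hXY] with d h1 h2 h3
    refine ⟨h1, ?_⟩
    rw [← h3]
    exact h2
  have hYF : ∀ᵐ d ∂harrisMeasure V p, Y d ∉ F₁ := by
    have hm : MeasurableSet {d | Y d ∉ F₁} := (hY hF₁).compl
    rw [harrisMeasure, Measure.ae_prod_iff_ae_ae hm]
    filter_upwards [Measure.ae_ae_of_ae_prod hgood, hall] with η₀ h1 h2
    refine (Measure.ae_prod_iff_ae_ae (measurable_prodMk_left hm)).2 ?_
    filter_upwards [Measure.ae_ae_of_ae_prod h1, h2] with ξ h3 h4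
    by_cases hT : IsRegularClock N (ringTime ξ)
    · filter_upwards [h3, h4 hT] with U h5 h6
      rintro ⟨M, hM⟩
      obtain ⟨m, hm⟩ := exists_staysOne_of_dense hT
        (fun t => h5.2.eq_spinState hdep hN h5.1 t w) hD hM
      exact h6 m hm
    · filter_upwards [h3] with U h5 using absurd h5.1 hT
  have hP₁ : P ((fun ω t => σ t ω) ⁻¹' F₁) = 0 := by
    rw [hid.measure_mem_eq hF₁]
    refine measure_eq_zero_iff_ae_notMem.2 ?_
    filter_upwards [hYF, hXY] with d h1 h2 h3
    refine h1 ?_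
    rw [← h2]
    exact h3
  refine hw.ne' (measure_mono_null ?_ hP₁)
  rintro ω ⟨-, hω⟩
  obtain ⟨M, hM⟩ := eventually_atTop.1 hω
  obtain ⟨n, hn⟩ := exists_nat_ge M
  exact ⟨n, fun q _ hq => hM q (hn.trans hq)⟩
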